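/- Let $d\in\{2,3\}$ and let $\Omega\subset\mathbb R^d$ be a bounded open set with Lipschitz boundary. For each $n\in\mathbb N$ let $\mathcal G_n$ be a finite partition of $\overline\Omega$ into closed simplices $E$ with pairwise disjoint interiors, each equipped with a nonsingular affine map $F_E$ of $E$ onto the closed reference simplex $\hat E=\{x\in\mathbb R^d: x_i\ge 0,\ \sum_i x_i\le 1\}$. Assume that $\{\mathcal G_n\}$ is shape-regular: there is $\sigma<\infty$ such that, for all $n$ and all $E\in\mathcal G_n$, $\operatorname{diam}E\le\sigma\rho_E$ for the radius $\rho_E>0$ of some closed ball contained in $E$. For $E\in\mathcal G_n$ put $S_E=\bigcup\{E'\in\mathcal G_n:E'\cap E\neq\emptyset\}$. Let $\hat{\mathbb P}_{\mathbb Q}\subset L^\infty(\hat E)$ be a fixed finite-dimensional subspace and let $$\mathbb Q^n=\{Q\in L^\infty(\Omega): Q|_E\circ F_E^{-1}\in\hat{\mathbb P}_{\mathbb Q}\ \text{ for all } E\in\mathcal G_n\}.$$ For each $n$ let $\Pi^n_{\mathbb Q}:L^1(\Omega)\to\mathbb Q^n$ be a linear projection (that is, $\Pi^n_{\mathbb Q}Q=Q$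 for $Q\in\mathbb Q^n$), and assume that there is a constant $c_2>0$, independent of $n$, with $$\frac1{|E|}\int_E|\Pi^n_{\mathbb Q}q|\,dx\le c_2\,\frac1{|S_E|}\int_{S_E}|q|\,dx\qquad\text{for all } n\in\mathbb N,\ q\in L^1(\Omega),\ E\in\mathcal G_n.$$ For an exponent $s:\overline\Omega\to(1,\infty)$ let $L^{s(\cdot)}(\Omega)$ be the space of all $u\in L^1_{\rm loc}(\Omega)$ with $\int_\Omega|u(x)|^{s(x)}\,dx<\infty$, with the Luxemburg norm $\|u\|_{s(\cdot)}=\inf\{\lambda>0:\int_\Omega|u(x)/\lambda|^{s(x)}\,dx\le1\}$. **Proposition.** Let $\alpha\in(0,1)$, let $r$ and $r^n$ ($n\in\mathbb N$) belong to $C^{0,\alpha}(\overline\Omega)$, with $r^n(x)>1$ for all $x\in\overline\Omega$ and $n\in\mathbb N$, and let $r^n\to r$ in $C^{0,\alpha}(\overline\Omega)$. Then $L^{r^n(\cdot)}(\Omega)\subset L^1(\Omega)$ for every $n$, and there exists a constant $C<\infty$, independent of $n$, such that $$\|\Pi^n_{\mathbb Q}q\|_{r^n(\cdot)}\le C\,\|q\|_{r^n(\cdot)}\qquad\text{for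 all } n\in\mathbb N\ \text{ and all } q\in L^{r^n(\cdot)}(\Omega).$$ -/

import Mathlib

open MeasureTheory Filter Topology Set
open scoped NNReal ENNReal

noncomputable section

namespace VarExpFEM

/-- The ambient Euclidean space `ℝ^d`. -/
abbrev Space (d : ℕ) : Type := EuclideanSpace ℝ (Fin d)

/-- `Ω` has Lipschitz boundary: near each boundary point, `Ω` is the set of points lying strictly
above the graph of a Lipschitz function `g`, where "height" is measured in the direction of some
unit vector `e` and `g` is a function on the hyperplane orthogonal to `e`. -/
def HasLipschitzBoundary {d : ℕ} (Ω : Set (Space d)) : Prop :=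
  ∀ x₀ ∈ frontier Ω, ∃ (e : Space d) (L : ℝ≥0) (g : (ℝ ∙ e)ᗮ → ℝ),
    ‖e‖ = 1 ∧ LipschitzWith L g ∧
      ∀ᶠ x in 𝓝 x₀, (x ∈ Ω ↔ g ((ℝ ∙ e)ᗮ.orthogonalProjectionOnto x) < inner ℝ e x)

/-- The `C^{0,α}(closure Ω)` norm: the supremum of `|f|` over the closure of `Ω` plus the
`α`-Hölder seminorm of `f` there.  It is `⊤` exactly when `f` is not in `C^{0,α}(closure Ω)`. -/
def holderNorm {d : ℕ} (Ω : Set (Space d)) (α : ℝ≥0) (f : Space d → ℝ) : ℝ≥0∞ :=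
  (⨆ x ∈ closure Ω, ‖f x‖ₑ) + eHolderNorm α ((closure Ω).domRestrict f)

/-- The modular `∫_Ω |u(x)|^{r(x)} dx`. -/
def modular {d : ℕ} (Ω : Set (Space d)) (r : Space d → ℝ) (u : Space d → ℝ) : ℝ≥0∞ :=
  ∫⁻ x in Ω, ‖u x‖ₑ ^ r x

/-- Membership of (a representative of) `u` in `L^{r(·)}(Ω)`. -/
def MemVarLebesgue {d : ℕ} (Ω : Set (Space d)) (r : Space d → ℝ) (u : Space d → ℝ) : Prop :=
  LocallyIntegrableOn u Ω ∧ modular Ω r u < ⊤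

/-- The Luxemburg norm of `L^{r(·)}(Ω)`.  It is extended-valued, so that the infimum of the empty
set is `⊤`. -/
def luxemburgNorm {d : ℕ} (Ω : Set (Space d)) (r : Space d → ℝ) (u : Space d → ℝ) : ℝ≥0∞ :=
  sInf (ENNReal.ofReal '' {t : ℝ | 0 < t ∧ modular Ω r (fun x => u x / t) ≤ 1})

/-- The closed standard reference `d`-simplex. -/
def refSimplex (d : ℕ) : Set (Space d) :=
  {x | (∀ i, 0 ≤ x i) ∧ ∑ i, x i ≤ 1}

/-- A finite partition of the closure of `Ω` into closed simplices with pairwise disjoint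
interiors.  Each element `E` comes with its nonsingular affine map `F E` onto the reference
simplex. -/
structure Mesh {d : ℕ} (Ω : Set (Space d)) where
  elements : Set (Set (Space d))
  finite_elements : elements.Finite
  F : Set (Space d) → (Space d ≃ᵃ[ℝ] Space d)
  image_F : ∀ E ∈ elements, F E '' E = refSimplex d
  sUnion_elements : ⋃₀ elements = closure Ω
  disjoint_interior : elements.Pairwise fun E E' => Disjoint (interior E) (interior E')

/-- The patch `S_E`: the union of all elements that meet `E`. -/
def Mesh.patch {d : ℕ} {Ω : Set (Space d)} (G : Mesh Ω) (E : Set (Space d)) : Set (Space d) :=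
  ⋃₀ {E' | E' ∈ G.elements ∧ (E' ∩ E).Nonempty}

/-- Shape-regularity of a sequence of meshes: the ratio of the diameter of an element to the
radius of its largest inscribed ball is bounded, uniformly over all elements of all meshes. -/
def ShapeRegular {d : ℕ} {Ω : Set (Space d)} (G : ℕ → Mesh Ω) : Prop :=
  ∃ σ : ℝ, ∀ n, ∀ E ∈ (G n).elements, ∃ (c : Space d) (ρ : ℝ),
    0 < ρ ∧ Metric.closedBall c ρ ⊆ E ∧ Metric.diam E ≤ σ * ρ

/-- The discrete pressure space of a mesh, as a set of elements of `L¹(Ω)`: the essentially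
bounded functions `Q` such that, for each element `E`, the function `Q|_E ∘ F_E⁻¹` belongs to the
given space `P` of functions on the reference simplex. -/
def pressureSpace {d : ℕ} {Ω : Set (Space d)} (G : Mesh Ω)
    (P : Submodule ℝ (Lp ℝ ∞ (volume.restrict (refSimplex d)))) :
    Set (Lp ℝ 1 (volume.restrict Ω)) :=
  {Q | MemLp Q ∞ (volume.restrict Ω) ∧
    ∀ E ∈ G.elements, ∃ p ∈ P,
      (fun y => Q ((G.F E).symm y)) =ᵐ[volume.restrict (refSimplex d)] p}

/-- A sequence of linear projections `Π n` of `L¹(Ω)` onto the discrete pressure spaces that is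
locally `L¹`-stable with a constant independent of `n`. -/
structure IsStablePressureProjection {d : ℕ} {Ω : Set (Space d)} (G : ℕ → Mesh Ω)
    (P : Submodule ℝ (Lp ℝ ∞ (volume.restrict (refSimplex d))))
    (Pi : ℕ → (Lp ℝ 1 (volume.restrict Ω) →ₗ[ℝ] Lp ℝ 1 (volume.restrict Ω))) : Prop where
  mem : ∀ n q, Pi n q ∈ pressureSpace (G n) P
  fixes : ∀ n, ∀ Q ∈ pressureSpace (G n) P, Pi n Q = Q
  stable : ∃ c : ℝ, 0 < c ∧ ∀ n q, ∀ E ∈ (G n).elements,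
    ⨍ x in E, |Pi n q x| ≤ c * ⨍ x in (G n).patch E, |q x|

end VarExpFEM

end

/-!
By homogeneity of the Luxemburg norm it suffices to bound the modular of the projection `Π q`
uniformly over all `q` whose modular is at most one.

On an element `E`, finite-dimensionality of the reference space gives the inverse estimate
(`exists_inverse_estimate`), by which `|Π q|` is pointwise bounded by a multiple of its mean over
`E`; local stability bounds this by a multiple of the mean of `|q|` over the patch `S_E`. Since the
modular of `q` is at most one, this mean is at most of the order of a negative power of `|S_E|`, and
the Hölder exponent oscillates over `S_E` by at most a multiple of `|S_E| ^ (α / d)`. Hence in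
Jensen's inequality the variable exponent may be treated as a constant up to a bounded factor
(`rpow_laverage_le`):
`(⨍_{S_E} |q|) ^ p(x) ≤ C (⨍_{S_E} |q| ^ p + 1)` for `x ∈ E`.

Integrating over `E` and summing over the mesh leaves the sum of `(|E| / |S_E|) ∫_{S_E} |q| ^ p`,
that is, the integral of `|q| ^ p` against a weight which on `E'` is the sum of `|E| / |S_E|` over
the elements `E` touching `E'`. This weight is bounded (`Mesh.IsRegular.sum_volume_div_le`). Meshes
may be nonconforming, so neither are neighbouring elements of comparable size nor is their number
bounded; but contracting each large neighbour towards its contact point with `E'` yields disjoint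
sets in a ball of volume comparable with `|E'|`.

The Lipschitz boundary enters only through being a null set: elements are subsets of the closure of
`Ω`, whereas integrability and modulars refer to `Ω`.
-/

namespace VarExpFEM

/-! ### The boundary is a null set -/

/-- Near a boundary point the frontier lies in the graph of a Lipschitz function, and such a graph is
null because infinitely many bounded translates of it are pairwise disjoint. -/
theorem volume_frontier_eq_zero {d : ℕ} {Ω : Set (Space d)} (hΩ : IsOpen Ω)
    (hlip : HasLipschitzBoundary Ω) : volume (frontier Ω) = 0 := by
  refine measure_null_of_locally_null _ fun x₀ hx₀ => ?_
  obtain ⟨e, L, g, he, hg, hev⟩ := hlip x₀ hx₀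
  obtain ⟨U, hU, hUo, hxU⟩ := eventually_nhds_iff.1 hev
  set φ : Space d → ℝ := fun x => inner ℝ e x - g ((ℝ ∙ e)ᗮ.orthogonalProjectionOnto x) with hφ
  have hφc : Continuous φ := by
    have := hg.continuous
    fun_prop
  refine ⟨frontier Ω ∩ U, inter_mem_nhdsWithin _ (hUo.mem_nhds hxU), ?_⟩
  have hsub : frontier Ω ∩ U ⊆ {x | φ x = 0} := by
    rintro x ⟨hxf, hx⟩
    rw [hΩ.frontier_eq] at hxf
    have h1 : φ x ≤ 0 := by
      by_contra! h
      exact hxf.2 ((hU x hx).2 (by simpa [hφ] using h))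
    refine le_antisymm h1 ?_
    by_contra! h
    have hmem : {y | φ y < 0} ∩ U ∈ 𝓝 x :=
      inter_mem ((isOpen_lt hφc continuous_const).mem_nhds h) (hUo.mem_nhds hx)
    obtain ⟨y, ⟨hy1, hy2⟩, hyΩ⟩ := mem_closure_iff_nhds.1 hxf.1 _ hmem
    have := (hU y hy2).1 hyΩ
    simp only [hφ, mem_ofPred_eq, sub_neg] at hy1
    linarith
  refine measure_mono_null hsub ?_
  have hφe : ∀ (t : ℝ) x, φ (t • e + x) = t + φ x := by
    intro t x
    have h0 : (ℝ ∙ e)ᗮ.orthogonalProjectionOnto (t • e) = 0 := by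
      rw [Submodule.orthogonalProjectionOnto_eq_zero_iff, Submodule.orthogonal_orthogonal]
      exact Submodule.smul_mem _ _ (Submodule.mem_span_singleton_self e)
    simp only [hφ, map_add, h0, zero_add, inner_add_right, inner_smul_right,
      real_inner_self_eq_norm_sq, he]
    ring
  -- The translates of the graph by distinct multiples of `e` are disjoint.
  refine Measure.addHaar_eq_zero_of_disjoint_translates volume
    (fun n : ℕ => ((1 : ℝ) / (n + 1)) • e) ?_ ?_ (hφc.measurable (measurableSet_singleton 0))
  · refine (Metric.isBounded_closedBall (x := (0 : Space d)) (r := 1)).subset ?_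
    rintro _ ⟨n, rfl⟩
    have h : (0 : ℝ) < n + 1 := by positivity
    simp only [mem_closedBall_zero_iff, norm_smul, he, mul_one, Real.norm_eq_abs]
    rw [abs_of_pos (by positivity), div_le_one h]
    linarith [(Nat.cast_nonneg n : (0 : ℝ) ≤ n)]
  · intro m n hmn
    rw [Function.onFun, Set.disjoint_left]
    intro y hy hy'
    simp only [singleton_add, mem_image, mem_ofPred_eq] at hy hy'
    obtain ⟨a, ha, rfl⟩ := hy
    obtain ⟨b, hb, hab⟩ := hy'
    have := congrArg φ hab
    rw [hφe, hφe, ha, hb, add_zero, add_zero] at this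
    apply hmn
    have h1 : (0 : ℝ) < m + 1 := by positivity
    have h2 : (0 : ℝ) < n + 1 := by positivity
    rw [div_eq_div_iff h2.ne' h1.ne', one_mul, one_mul] at this
    exact_mod_cast (add_right_cancel this)

/-! ### Uniform bounds on the exponents -/

/-- Only the Hölder seminorms matter: they are bounded along the convergent tail, and the remaining
finitely many exponents contribute a finite sum. -/
theorem exists_uniform_holder_bound {d : ℕ} {Ω : Set (Space d)} {α : ℝ≥0}
    {r : Space d → ℝ} {rn : ℕ → Space d → ℝ} (hr : holderNorm Ω α r < ⊤)
    (hrn : ∀ n, holderNorm Ω α (rn n) < ⊤)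
    (hconv : Tendsto (fun n => holderNorm Ω α (rn n - r)) atTop (𝓝 0)) :
    ∃ M : ℝ≥0, ∀ n, HolderOnWith M α (rn n) (closure Ω) := by
  set N : (Space d → ℝ) → ℝ≥0∞ := fun f => eHolderNorm α ((closure Ω).domRestrict f) with hN
  have hle : ∀ f, N f ≤ holderNorm Ω α f := fun f => le_add_self
  have hb : ∃ M : ℝ≥0, ∀ n, N (rn n) ≤ M := by
    obtain ⟨n₀, hn₀⟩ := eventually_atTop.1 (hconv.eventually (gt_mem_nhds zero_lt_one))
    have hfin : ∀ n, N (rn n) ≠ ⊤ := fun n => ((hle _).trans_lt (hrn n)).ne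
    have hfr : N r ≠ ⊤ := ((hle _).trans_lt hr).ne
    refine ⟨∑ n ∈ Finset.range n₀, (N (rn n)).toNNReal + ((N r).toNNReal + 1), fun n => ?_⟩
    rcases lt_or_ge n n₀ with h | h
    · rw [← ENNReal.coe_toNNReal (hfin n)]
      refine ENNReal.coe_le_coe.2 (le_add_right ?_)
      exact Finset.single_le_sum (f := fun n => (N (rn n)).toNNReal)
        (fun _ _ => zero_le) (Finset.mem_range.2 h)
    · have h1 : N (rn n) ≤ N r + N (rn n - r) := by
        have : (closure Ω).domRestrict (rn n)
            = (closure Ω).domRestrict r + (closure Ω).domRestrict (rn n - r) := by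
          ext x; simp
        simp only [hN]
        rw [this]
        exact eHolderNorm_add_le
      refine h1.trans ?_
      push_cast
      rw [ENNReal.coe_toNNReal hfr]
      exact le_add_left (add_le_add le_rfl ((hle _).trans (hn₀ n h).le))
  obtain ⟨M, hM⟩ := hb
  refine ⟨M, fun n => ?_⟩
  have hmem : MemHolder α ((closure Ω).domRestrict (rn n)) :=
    eHolderNorm_lt_top.1 ((hM n).trans_lt ENNReal.coe_lt_top)
  intro x hx y hy
  have h2 := hmem.holderWith ⟨x, hx⟩ ⟨y, hy⟩
  refine h2.trans ?_
  rw [Subtype.edist_mk_mk]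
  gcongr
  exact ENNReal.coe_le_coe.1 (coe_nnHolderNorm_le_eHolderNorm.trans (hM n))

/-! ### Powers of means -/

/-- Jensen's inequality for the constant exponent `m`, followed by `s ^ m ≤ s ^ p y + 1`. -/
theorem lintegral_rpow_le_lintegral_rpow_add_one {X : Type*} [MeasurableSpace X] {μ : Measure X}
    [IsProbabilityMeasure μ] {f : X → ℝ} (hf : AEStronglyMeasurable f μ) {p : X → ℝ} {m : ℝ}
    (hm : 1 ≤ m) (hp : ∀ᵐ y ∂μ, m ≤ p y) :
    (∫⁻ y, ‖f y‖ₑ ∂μ) ^ m ≤ ∫⁻ y, ‖f y‖ₑ ^ p y ∂μ + 1 := by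
  have hm0 : 0 < m := by linarith
  have h1 := eLpNorm'_le_eLpNorm'_of_exponent_le zero_lt_one hm μ hf
  simp only [eLpNorm', ENNReal.rpow_one, div_one] at h1
  rw [one_div, ENNReal.le_rpow_inv_iff hm0] at h1
  refine h1.trans ?_
  have h2 : ∫⁻ y, ‖f y‖ₑ ^ m ∂μ ≤ ∫⁻ y, (‖f y‖ₑ ^ p y + 1) ∂μ := by
    refine lintegral_mono_ae ?_
    filter_upwards [hp] with y hy
    rcases le_total ‖f y‖ₑ 1 with h | h
    · exact le_add_left (ENNReal.rpow_le_one h hm0.le)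
    · exact le_add_right (ENNReal.rpow_le_rpow_of_exponent_le h hy)
  refine h2.trans ?_
  rw [lintegral_add_right _ measurable_const]
  simp

/-- Raising the bound `a ^ m ≤ A + 1` to the power `P / m` costs only the factor `(A + 1) ^ (P - m)`,
for which the a priori bound `B` on `A + 1` is good enough. -/
theorem rpow_le_mul_of_rpow_le {a A B C : ℝ≥0∞} {m P δ : ℝ} (hm : 1 ≤ m) (hmP : m ≤ P)
    (hδ : P - m ≤ δ) (ha : a ^ m ≤ A + 1) (hAB : A + 1 ≤ B) (hB : B ≠ ⊤) (hC : B ^ δ ≤ C) :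
    a ^ P ≤ C * (A + 1) := by
  have hm0 : 0 < m := by linarith
  have hP0 : 0 < P := by linarith
  have h1 : (1 : ℝ≥0∞) ≤ A + 1 := le_add_self
  have hB1 : 1 ≤ B := h1.trans hAB
  calc a ^ P = (a ^ m) ^ (P / m) := by rw [← ENNReal.rpow_mul, mul_div_cancel₀ _ hm0.ne']
    _ ≤ (A + 1) ^ (P / m) := ENNReal.rpow_le_rpow ha (by positivity)
    _ = (A + 1) ^ ((P - m) / m) * (A + 1) := by
      conv_rhs => rw [← ENNReal.rpow_one (A + 1), ← ENNReal.rpow_mul]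
      rw [← ENNReal.rpow_add _ _ (zero_lt_one.trans_le h1).ne' (hAB.trans_lt hB.lt_top).ne]
      congr 1
      field_simp
      ring
    _ ≤ C * (A + 1) := by
      gcongr
      calc (A + 1) ^ ((P - m) / m) ≤ B ^ ((P - m) / m) := by gcongr
        _ ≤ B ^ δ := by
          refine ENNReal.rpow_le_rpow_of_exponent_le hB1 ?_
          exact (div_le_self (by linarith) hm).trans hδ
        _ ≤ C := hC

/-- The log-Hölder estimate: an inverse volume `s⁻¹` raised to the oscillation `M * D ^ α` of a Hölder
exponent over a set of diameter `D` stays bounded, provided `D ^ d` is at most a multiple of `s`.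
Indeed `log (1 + s⁻¹)` grows more slowly than `s ^ (-α / d)`. -/
theorem one_add_inv_rpow_le {d : ℕ} (hd : d ≠ 0) {α M c V s D : ℝ} (hα : 0 < α) (hM : 0 ≤ M)
    (hc : 0 ≤ c) (hs : 0 < s) (hsV : s ≤ V) (hD : 0 ≤ D) (hDs : D ^ d ≤ c * s) :
    (1 + s⁻¹) ^ (M * D ^ α) ≤ Real.exp (M * ((c * (V + 1)) ^ (α / d) / (α / d))) := by
  have hd0 : (0 : ℝ) < d := by positivity
  have hε : 0 < α / d := by positivity
  have hb : 0 < 1 + s⁻¹ := by positivity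
  rw [Real.rpow_def_of_pos hb, Real.exp_le_exp]
  have h1 : D ^ α = (D ^ d) ^ (α / d) := by
    rw [← Real.rpow_natCast, ← Real.rpow_mul hD]
    congr 1
    field_simp
  have h2 : Real.log (1 + s⁻¹) ≤ (1 + s⁻¹) ^ (α / d) / (α / d) :=
    Real.log_le_rpow_div hb.le hε
  calc Real.log (1 + s⁻¹) * (M * D ^ α) = M * (Real.log (1 + s⁻¹) * D ^ α) := by ring
    _ ≤ M * ((1 + s⁻¹) ^ (α / d) / (α / d) * (c * s) ^ (α / d)) := by
      rw [h1]
      gcongr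
    _ = M * ((c * (s + 1)) ^ (α / d) / (α / d)) := by
      have : c * (s + 1) = (1 + s⁻¹) * (c * s) := by field_simp
      rw [this, Real.mul_rpow hb.le (by positivity)]
      ring
    _ ≤ _ := by gcongr

/-! ### Geometry of a single element -/

/-- A convex set `E` touching `E'` is contracted towards a common point until its diameter is at most
that of `E'`.  The resulting copy `H` stays in `interior E` and close to `E'`, and it has either the
volume of `E` (if no contraction is needed) or a volume comparable with that of `E'`. -/
theorem exists_contracted_copy {d : ℕ} {E E' : Set (Space d)} {z : Space d}
    {κ : ℝ≥0∞} (hE : Convex ℝ E) (hEb : Bornology.IsBounded E)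
    (hE'b : Bornology.IsBounded E')
    (hz : z ∈ E') (hne : (E ∩ E').Nonempty) (hE0 : 0 < Metric.diam E) (hE'0 : 0 < Metric.diam E')
    (hκ : ENNReal.ofReal (Metric.diam E ^ d) * volume (Metric.closedBall (0 : Space d) 1)
      ≤ κ * volume E) :
    ∃ H ⊆ interior E, MeasurableSet H ∧ H ⊆ Metric.closedBall z (2 * Metric.diam E') ∧
      (volume E ≤ volume H ∨ volume E' ≤ κ * volume H) := by
  obtain ⟨x, hxE, hxE'⟩ := hne
  set h := Metric.diam E
  set h' := Metric.diam E'
  set t : ℝ := min 1 (h' / h) with ht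
  have ht0 : 0 < t := lt_min one_pos (div_pos hE'0 hE0)
  have ht1 : t ≤ 1 := min_le_left _ _
  have hth : t * h ≤ h' := by
    calc t * h ≤ h' / h * h := by gcongr; exact min_le_right _ _
      _ = h' := div_mul_cancel₀ _ hE0.ne'
  have hvol : volume (AffineMap.homothety x t '' interior E)
      = ENNReal.ofReal (t ^ d) * volume E := by
    rw [Measure.addHaar_image_homothety, finrank_euclideanSpace_fin, abs_of_pos (by positivity)]
    congr 1
    refine le_antisymm (measure_mono interior_subset) ?_
    calc volume E ≤ volume (interior E ∪ frontier E) := by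
          refine measure_mono ?_
          rw [← closure_eq_interior_union_frontier]
          exact subset_closure
      _ ≤ volume (interior E) + volume (frontier E) := measure_union_le _ _
      _ = volume (interior E) := by rw [hE.addHaar_frontier volume, add_zero]
  refine ⟨AffineMap.homothety x t '' interior E, ?_, ?_, ?_, ?_⟩
  · rintro _ ⟨y, hy, rfl⟩
    have := hE.combo_interior_self_subset_interior (a := t) (b := 1 - t) ht0 (by linarith)
      (by ring)
    refine this ?_
    refine Set.mem_add.2 ⟨t • y, Set.smul_mem_smul_set hy, (1 - t) • x,
      Set.smul_mem_smul_set hxE, ?_⟩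
    rw [AffineMap.homothety_apply, vsub_eq_sub, vadd_eq_add]
    module
  · exact (AffineMap.homothety_isOpenMap x t ht0.ne' _ isOpen_interior).measurableSet
  · rintro _ ⟨y, hy, rfl⟩
    rw [Metric.mem_closedBall]
    calc dist (AffineMap.homothety x t y) z
        ≤ dist (AffineMap.homothety x t y) x + dist x z := dist_triangle _ _ _
      _ ≤ t * h + h' := by
        gcongr
        · rw [AffineMap.homothety_apply, vsub_eq_sub, vadd_eq_add, dist_eq_norm,
            add_sub_cancel_right, norm_smul, Real.norm_eq_abs, abs_of_pos ht0, ← dist_eq_norm]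
          gcongr
          exact Metric.dist_le_diam_of_mem hEb (interior_subset hy) hxE
        · exact Metric.dist_le_diam_of_mem hE'b hxE' hz
      _ ≤ 2 * h' := by linarith
  · rw [hvol]
    rcases le_total 1 (h' / h) with hc | hc
    · left
      rw [ht, min_eq_left hc]
      simp
    · right
      rw [ht, min_eq_right hc]
      calc volume E' ≤ volume (Metric.closedBall z h') :=
            measure_mono fun y hy => Metric.dist_le_diam_of_mem hE'b hy hz
        _ = ENNReal.ofReal (h' ^ d) * volume (Metric.closedBall (0 : Space d) 1) := by
          rw [Measure.addHaar_closedBall' _ _ hE'0.le, finrank_euclideanSpace_fin]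
        _ = ENNReal.ofReal ((h' / h) ^ d)
            * (ENNReal.ofReal (h ^ d) * volume (Metric.closedBall (0 : Space d) 1)) := by
          rw [← mul_assoc, ← ENNReal.ofReal_mul (by positivity), ← mul_pow,
            div_mul_cancel₀ _ hE0.ne']
        _ ≤ ENNReal.ofReal ((h' / h) ^ d) * (κ * volume E) := by gcongr
        _ = κ * (ENNReal.ofReal ((h' / h) ^ d) * volume E) := by ring

/-! ### Variable powers of means -/

/-- The key estimate for variable exponents.  If the modular of `f` over `S` is at most one, then the
power `p x` of the mean of `|f|` over `S` is controlled by the mean of `|f| ^ p` plus one. -/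
theorem rpow_laverage_le {d : ℕ} (hd : d ≠ 0) {S : Set (Space d)} {x : Space d} {p f : Space d → ℝ}
    {α M : ℝ≥0} (hα : 0 < α) {c V : ℝ} (hc : 0 ≤ c)
    (hS0 : volume S ≠ 0) (hSV : volume S ≤ ENNReal.ofReal V) (hSm : MeasurableSet S)
    (hdist : ∀ y ∈ S, dist x y ^ d ≤ c * volume.real S)
    (hp : ∀ y ∈ S, dist (p x) (p y) ≤ M * dist x y ^ (α : ℝ)) (hpx : 1 < p x)
    (hp1 : ∀ y ∈ S, 1 < p y) (hf : AEStronglyMeasurable f (volume.restrict S))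
    (hmod : ∫⁻ y in S, ‖f y‖ₑ ^ p y ≤ 1) :
    ((volume S)⁻¹ * ∫⁻ y in S, ‖f y‖ₑ) ^ p x ≤
      ENNReal.ofReal (Real.exp (M * ((c * (V + 1)) ^ ((α : ℝ) / d) / ((α : ℝ) / d)))) *
        ((volume S)⁻¹ * (∫⁻ y in S, ‖f y‖ₑ ^ p y) + 1) := by
  have hStop : volume S ≠ ⊤ := (hSV.trans_lt ENNReal.ofReal_lt_top).ne
  have hs : 0 < volume.real S := ENNReal.toReal_pos hS0 hStop
  have hsV : volume.real S ≤ V := by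
    rcases le_or_gt V 0 with h | h
    · rw [ENNReal.ofReal_of_nonpos h] at hSV
      exact absurd (le_antisymm hSV zero_le) hS0
    · exact ENNReal.toReal_le_of_le_ofReal h.le hSV
  have hα' : (0 : ℝ) < α := hα
  set s := volume.real S with hsdef
  -- `D` is the radius about `x` for which `hdist` is sharp, so `δ` bounds the oscillation of `p`
  -- over `S` and `m` is a constant lower bound for `p` there, within `δ` of `p x`.
  set D : ℝ := (c * s) ^ ((d : ℝ)⁻¹) with hD
  have hcs : 0 ≤ c * s := by positivity
  have hD0 : 0 ≤ D := by positivity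
  have hDd : D ^ d = c * s := Real.rpow_inv_natCast_pow hcs hd
  have hdD : ∀ y ∈ S, dist x y ≤ D := fun y hy =>
    le_of_pow_le_pow_left₀ hd hD0 ((hdist y hy).trans_eq hDd.symm)
  set δ : ℝ := M * D ^ (α : ℝ) with hδ
  have hδ0 : 0 ≤ δ := by positivity
  set m : ℝ := max 1 (p x - δ) with hm
  have hmS : ∀ y ∈ S, m ≤ p y := by
    intro y hy
    refine max_le (hp1 y hy).le ?_
    have h1 : M * dist x y ^ (α : ℝ) ≤ δ := by
      rw [hδ]
      gcongr
      exact hdD y hy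
    have h2 := (abs_le.1 ((Real.dist_eq _ _).symm.trans_le ((hp y hy).trans h1))).2
    linarith
  set μ : Measure (Space d) := (volume S)⁻¹ • volume.restrict S with hμ
  have : IsProbabilityMeasure μ := ⟨by
    simp only [hμ, Measure.smul_apply, Measure.restrict_apply MeasurableSet.univ, univ_inter,
      smul_eq_mul]
    exact ENNReal.inv_mul_cancel hS0 hStop⟩
  have hae : ∀ᵐ y ∂μ, m ≤ p y :=
    Measure.ae_smul_measure ((ae_restrict_iff' hSm).2 (Eventually.of_forall hmS)) _
  have hJ := lintegral_rpow_le_lintegral_rpow_add_one (hf.smul_measure _) (le_max_left _ _) hae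
  simp only [lintegral_smul_measure, smul_eq_mul] at hJ
  refine rpow_le_mul_of_rpow_le (B := 1 + (volume S)⁻¹) (δ := δ) (le_max_left 1 (p x - δ))
    (max_le hpx.le (by linarith)) (by linarith [le_max_right 1 (p x - δ)]) hJ ?_ ?_ ?_
  · rw [add_comm]
    gcongr
    exact mul_le_of_le_one_right' hmod
  · simp [hS0]
  · have h := one_add_inv_rpow_le hd hα' M.2 hc hs hsV hD0 hDd.le
    have h2 : 1 + (volume S)⁻¹ = ENNReal.ofReal (1 + s⁻¹) := by
      rw [ENNReal.ofReal_add zero_le_one (by positivity), ENNReal.ofReal_one,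
        ENNReal.ofReal_inv_of_pos hs, hsdef, ofReal_measureReal hStop]
    rw [h2, ENNReal.ofReal_rpow_of_pos (by positivity)]
    exact ENNReal.ofReal_le_ofReal h

/-! ### Regular meshes and their patches -/

namespace Mesh

variable {d : ℕ} {Ω : Set (Space d)} {G : Mesh Ω} {E E' : Set (Space d)}

theorem subset_closure (hE : E ∈ G.elements) : E ⊆ closure Ω :=
  (subset_sUnion_of_mem hE).trans_eq G.sUnion_elements

theorem symm_preimage (hE : E ∈ G.elements) : (G.F E).symm ⁻¹' E = refSimplex d := by
  rw [← G.image_F E hE]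
  exact ((G.F E).toEquiv.image_eq_preimage_symm E).symm

theorem eq_preimage (hE : E ∈ G.elements) : E = G.F E ⁻¹' refSimplex d := by
  rw [← G.image_F E hE, (G.F E).injective.preimage_image]

theorem isClosed_refSimplex (d : ℕ) : IsClosed (refSimplex d) := by
  have : refSimplex d = (⋂ i, {x : Space d | 0 ≤ x i}) ∩ {x | ∑ i, x i ≤ 1} := by
    ext x
    simp [refSimplex]
  rw [this]
  refine (isClosed_iInter fun i => isClosed_le (by fun_prop) (by fun_prop)).inter
    (isClosed_le (by fun_prop) (by fun_prop))

theorem convex_refSimplex (d : ℕ) : Convex ℝ (refSimplex d) := by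
  rintro x ⟨hx, hx1⟩ y ⟨hy, hy1⟩ a b ha hb hab
  refine ⟨fun i => ?_, ?_⟩
  · simp only [PiLp.add_apply, PiLp.smul_apply, smul_eq_mul]
    have := hx i
    have := hy i
    positivity
  · simp only [PiLp.add_apply, PiLp.smul_apply, smul_eq_mul, Finset.sum_add_distrib,
      ← Finset.mul_sum]
    nlinarith

theorem isBounded_refSimplex (d : ℕ) : Bornology.IsBounded (refSimplex d) := by
  refine (Metric.isBounded_closedBall (x := (0 : Space d)) (r := 1)).subset ?_
  rintro x ⟨hx, hx1⟩
  rw [mem_closedBall_zero_iff, EuclideanSpace.norm_eq, Real.sqrt_le_one]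
  refine (Finset.sum_le_sum fun i _ => ?_).trans hx1
  have h1 : x i ≤ 1 := (Finset.single_le_sum (fun j _ => hx j) (Finset.mem_univ i)).trans hx1
  rw [Real.norm_eq_abs, sq_abs]
  nlinarith [hx i]

theorem isClosed (hE : E ∈ G.elements) : IsClosed E := by
  rw [eq_preimage hE]
  exact (isClosed_refSimplex d).preimage (G.F E).continuous_of_finiteDimensional

theorem convex (hE : E ∈ G.elements) : Convex ℝ E := by
  rw [eq_preimage hE]
  exact (convex_refSimplex d).affine_preimage (G.F E).toAffineMap

theorem finite_patch (G : Mesh Ω) (E : Set (Space d)) :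
    {E' | E' ∈ G.elements ∧ (E' ∩ E).Nonempty}.Finite :=
  G.finite_elements.subset fun _ h => h.1

theorem isClosed_patch (G : Mesh Ω) (E : Set (Space d)) : IsClosed (G.patch E) := by
  rw [patch, sUnion_eq_biUnion]
  exact (finite_patch G E).isClosed_biUnion fun _ h => isClosed h.1

theorem patch_subset (G : Mesh Ω) (E : Set (Space d)) : G.patch E ⊆ closure Ω :=
  sUnion_subset fun _ h => subset_closure h.1

theorem subset_patch (hE' : E' ∈ G.elements) (h : (E' ∩ E).Nonempty) : E' ⊆ G.patch E :=
  fun _ hx => ⟨E', ⟨hE', h⟩, hx⟩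

/-- Regularity of a mesh with constant `κ`: the volume of the ball whose radius is the diameter of
an element is at most `κ` times the volume of the element, and no element is a single point. -/
def IsRegular (G : Mesh Ω) (κ : ℝ≥0∞) : Prop :=
  ∀ E ∈ G.elements, 0 < Metric.diam E ∧
    ENNReal.ofReal (Metric.diam E ^ d) * volume (Metric.closedBall (0 : Space d) 1) ≤ κ * volume E

theorem volume_unitBall_pos (d : ℕ) : 0 < volume (Metric.closedBall (0 : Space d) 1) :=
  Metric.measure_closedBall_pos _ _ one_pos

theorem volume_unitBall_ne_top (d : ℕ) : volume (Metric.closedBall (0 : Space d) 1) ≠ ⊤ :=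
  Metric.isBounded_closedBall.measure_lt_top.ne

/-- Shape-regularity compares the diameter with the radius of an inscribed ball, hence with the
volume. -/
theorem _root_.VarExpFEM.ShapeRegular.exists_isRegular (hd : d ≠ 0)
    (hΩ : Bornology.IsBounded Ω) {G : ℕ → Mesh Ω} (hG : ShapeRegular G) :
    ∃ κ : ℝ≥0, 1 ≤ κ ∧ ∀ n, (G n).IsRegular κ := by
  obtain ⟨σ, hσ⟩ := hG
  refine ⟨max 1 (σ ^ d).toNNReal, le_max_left _ _, fun n E hE => ?_⟩
  obtain ⟨c, ρ, hρ, hball, hdiam⟩ := hσ n E hE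
  have hb : Bornology.IsBounded E := hΩ.closure.subset (subset_closure hE)
  have : Nonempty (Fin d) := ⟨⟨0, Nat.pos_of_ne_zero hd⟩⟩
  have h2 : 2 * ρ ≤ Metric.diam E := by
    rw [← Metric.diam_closedBall_eq c hρ.le]
    exact Metric.diam_mono hball hb
  have hpos : 0 < Metric.diam E := by linarith
  refine ⟨hpos, ?_⟩
  have hσ0 : 0 < σ := by
    by_contra! h
    nlinarith
  calc ENNReal.ofReal (Metric.diam E ^ d) * volume (Metric.closedBall (0 : Space d) 1)
      ≤ ENNReal.ofReal ((σ * ρ) ^ d) * volume (Metric.closedBall (0 : Space d) 1) := by gcongr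
    _ = ENNReal.ofReal (σ ^ d) * volume (Metric.closedBall c ρ) := by
      rw [Measure.addHaar_closedBall' _ _ hρ.le, finrank_euclideanSpace_fin, ← mul_assoc,
        ← ENNReal.ofReal_mul (by positivity), mul_pow]
    _ ≤ _ := by
      gcongr
      exact ENNReal.coe_le_coe.2 (le_max_right _ _)

theorem IsRegular.nonempty {κ : ℝ≥0∞} (hG : G.IsRegular κ) (hE : E ∈ G.elements) : E.Nonempty := by
  rw [nonempty_iff_ne_empty]
  rintro rfl
  simpa using (hG _ hE).1

theorem IsRegular.volume_pos {κ : ℝ≥0∞} (hG : G.IsRegular κ) (hE : E ∈ G.elements) :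
    volume E ≠ 0 := by
  intro h
  have h1 := (hG E hE).2
  rw [h, mul_zero, nonpos_iff_eq_zero, mul_eq_zero, ENNReal.ofReal_eq_zero] at h1
  rcases h1 with h1 | h1
  · exact absurd h1 (not_le.2 (pow_pos (hG E hE).1 d))
  · exact (volume_unitBall_pos d).ne' h1

/-- Patches are not assumed quasi-uniform, but the larger of two touching elements lies in the patch,
so that the volume of the patch dominates the `d`-th power of its size. -/
theorem IsRegular.dist_pow_le {κ : ℝ≥0} (hG : G.IsRegular κ) (hΩ : Bornology.IsBounded Ω)
    (hE : E ∈ G.elements) {x y : Space d} (hx : x ∈ E) (hy : y ∈ G.patch E) :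
    dist x y ^ d ≤
      2 ^ d * κ / volume.real (Metric.closedBall (0 : Space d) 1) * volume.real (G.patch E) := by
  obtain ⟨E', ⟨hE', z, hzE', hzE⟩, hyE'⟩ := hy
  have hb : Bornology.IsBounded E := hΩ.closure.subset (subset_closure hE)
  have hb' : Bornology.IsBounded E' := hΩ.closure.subset (subset_closure hE')
  have hSb : Bornology.IsBounded (G.patch E) := hΩ.closure.subset (patch_subset G E)
  have key : ∀ A ∈ G.elements, A ⊆ G.patch E → Metric.diam A ^ d *
      volume.real (Metric.closedBall (0 : Space d) 1) ≤ κ * volume.real (G.patch E) := by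
    intro A hA hAS
    have h := (hG A hA).2.trans (mul_le_mul_right (measure_mono hAS) _)
    have h' := ENNReal.toReal_mono
      (ENNReal.mul_ne_top ENNReal.coe_ne_top hSb.measure_lt_top.ne) h
    rwa [ENNReal.toReal_mul, ENNReal.toReal_mul, ENNReal.toReal_ofReal (by positivity)] at h'
  have hω : 0 < volume.real (Metric.closedBall (0 : Space d) 1) :=
    ENNReal.toReal_pos (volume_unitBall_pos d).ne' (volume_unitBall_ne_top d)
  have h1 : dist x y ≤ 2 * max (Metric.diam E) (Metric.diam E') := by
    calc dist x y ≤ dist x z + dist z y := dist_triangle _ _ _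
      _ ≤ Metric.diam E + Metric.diam E' := add_le_add (Metric.dist_le_diam_of_mem hb hx hzE)
          (Metric.dist_le_diam_of_mem hb' hzE' hyE')
      _ ≤ _ := by linarith [le_max_left (Metric.diam E) (Metric.diam E'),
          le_max_right (Metric.diam E) (Metric.diam E')]
  have h2 : max (Metric.diam E) (Metric.diam E') ^ d *
      volume.real (Metric.closedBall (0 : Space d) 1) ≤ κ * volume.real (G.patch E) := by
    rcases max_choice (Metric.diam E) (Metric.diam E') with h | h <;> rw [h]
    · exact key E hE (subset_patch hE ⟨z, hzE, hzE⟩)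
    · exact key E' hE' (subset_patch hE' ⟨z, hzE', hzE⟩)
  calc dist x y ^ d ≤ (2 * max (Metric.diam E) (Metric.diam E')) ^ d := by gcongr
    _ = 2 ^ d * max (Metric.diam E) (Metric.diam E') ^ d := mul_pow _ _ _
    _ ≤ 2 ^ d * (κ * volume.real (G.patch E) /
        volume.real (Metric.closedBall (0 : Space d) 1)) := by
      gcongr
      rwa [le_div_iff₀ hω]
    _ = _ := by ring

open Classical in
/-- Finite overlap of the patches, weighted by relative volume: for a fixed `E'`, the volume
fractions `|E| / |S_E|` of the elements `E` touching `E'` have bounded sum.  Hanging nodes are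
allowed, so the number of such `E` need not be bounded.  Each fraction is at most a multiple of
`|H_E| / |E'|`, where the contracted copies `H_E` of the elements are disjoint and contained in a
ball of volume comparable with `|E'|`. -/
theorem IsRegular.sum_volume_div_le {κ : ℝ≥0} (hκ : 1 ≤ κ) (hG : G.IsRegular κ)
    (hΩ : Bornology.IsBounded Ω) (hE' : E' ∈ G.elements) :
    ∑ E ∈ G.finite_elements.toFinset with (E' ∩ E).Nonempty, volume E / volume (G.patch E) ≤
      2 ^ d * κ ^ 2 := by
  have hbd : ∀ {A}, A ∈ G.elements → Bornology.IsBounded A := fun hA =>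
    hΩ.closure.subset (subset_closure hA)
  obtain ⟨z, hz⟩ := hG.nonempty hE'
  have hex : ∀ E : Set (Space d), ∃ H : Set (Space d), E ∈ G.elements → (E' ∩ E).Nonempty →
      H ⊆ interior E ∧ MeasurableSet H ∧ H ⊆ Metric.closedBall z (2 * Metric.diam E') ∧
        (volume E ≤ volume H ∨ volume E' ≤ κ * volume H) := by
    intro E
    by_cases h : E ∈ G.elements ∧ (E' ∩ E).Nonempty
    · obtain ⟨H, hH⟩ := exists_contracted_copy (convex h.1) (hbd h.1) (hbd hE') hz
        (by rw [inter_comm]; exact h.2) (hG E h.1).1 (hG E' hE').1 (hG E h.1).2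
      exact ⟨H, fun _ _ => hH⟩
    · exact ⟨∅, fun h1 h2 => absurd ⟨h1, h2⟩ h⟩
  choose H hH using hex
  set T := G.finite_elements.toFinset.filter fun E => (E' ∩ E).Nonempty with hT
  have hTm : ∀ E ∈ T, E ∈ G.elements ∧ (E' ∩ E).Nonempty := by
    intro E hE
    simpa [hT] using hE
  have hE'0 := hG.volume_pos hE'
  have hE't : volume E' ≠ ⊤ := (hbd hE').measure_lt_top.ne
  have hterm : ∀ E ∈ T, volume E / volume (G.patch E) ≤ κ / volume E' * volume (H E) := by
    intro E hE
    obtain ⟨hEG, hEE'⟩ := hTm E hE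
    obtain ⟨-, -, -, h⟩ := hH E hEG hEE'
    have hE'S : E' ⊆ G.patch E := subset_patch hE' hEE'
    have hES : E ⊆ G.patch E := subset_patch hEG (by simpa using hG.nonempty hEG)
    rcases h with h | h
    · calc volume E / volume (G.patch E) ≤ volume (H E) / volume E' := by gcongr
        _ = 1 * (volume (H E) / volume E') := (one_mul _).symm
        _ ≤ κ * (volume (H E) / volume E') := by
          gcongr
          exact ENNReal.one_le_coe_iff.2 hκ
        _ = _ := by rw [div_eq_mul_inv, div_eq_mul_inv]; ring
    · calc volume E / volume (G.patch E) ≤ volume (G.patch E) / volume (G.patch E) := by gcongr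
        _ ≤ 1 := ENNReal.div_self_le_one
        _ = volume E' / volume E' := (ENNReal.div_self hE'0 hE't).symm
        _ ≤ κ * volume (H E) / volume E' := by gcongr
        _ = _ := by rw [div_eq_mul_inv, div_eq_mul_inv]; ring
  have hsum : ∑ E ∈ T, volume (H E) ≤ 2 ^ d * κ * volume E' := by
    have hdisj : (T : Set (Set (Space d))).PairwiseDisjoint H := by
      intro A hA B hB hAB
      exact (G.disjoint_interior (hTm A hA).1 (hTm B hB).1 hAB).mono
        (hH A (hTm A hA).1 (hTm A hA).2).1 (hH B (hTm B hB).1 (hTm B hB).2).1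
    rw [← measure_biUnion_finset hdisj fun E hE => (hH E (hTm E hE).1 (hTm E hE).2).2.1]
    calc volume (⋃ E ∈ T, H E) ≤ volume (Metric.closedBall z (2 * Metric.diam E')) :=
          measure_mono (iUnion₂_subset fun E hE => (hH E (hTm E hE).1 (hTm E hE).2).2.2.1)
      _ = 2 ^ d * (ENNReal.ofReal (Metric.diam E' ^ d) *
          volume (Metric.closedBall (0 : Space d) 1)) := by
        rw [Measure.addHaar_closedBall' _ _ (by positivity), finrank_euclideanSpace_fin, mul_pow,
          ENNReal.ofReal_mul (by positivity), mul_assoc]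
        congr 1
        rw [ENNReal.ofReal_pow (by positivity)]
        simp
      _ ≤ 2 ^ d * (κ * volume E') := mul_le_mul_right (hG E' hE').2 _
      _ = _ := by ring
  calc ∑ E ∈ T, volume E / volume (G.patch E) ≤ ∑ E ∈ T, κ / volume E' * volume (H E) :=
        Finset.sum_le_sum hterm
    _ = κ / volume E' * ∑ E ∈ T, volume (H E) := by rw [Finset.mul_sum]
    _ ≤ κ / volume E' * (2 ^ d * κ * volume E') := by gcongr
    _ = 2 ^ d * κ ^ 2 * (volume E' / volume E') := by rw [div_eq_mul_inv, div_eq_mul_inv]; ring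
    _ = _ := by rw [ENNReal.div_self hE'0 hE't, mul_one]

theorem setLIntegral_le_sum (G : Mesh Ω) (g : Space d → ℝ≥0∞) :
    ∫⁻ x in Ω, g x ≤ ∑ E ∈ G.finite_elements.toFinset, ∫⁻ x in E, g x := by
  have h : Ω ⊆ ⋃ E : G.finite_elements.toFinset, (E : Set (Space d)) := by
    refine _root_.subset_closure.trans (G.sUnion_elements.symm.subset.trans ?_)
    rintro x ⟨E, hE, hx⟩
    exact mem_iUnion.2 ⟨⟨E, by simpa using hE⟩, hx⟩
  calc ∫⁻ x in Ω, g x ≤ _ := lintegral_mono_set h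
    _ ≤ _ := lintegral_iUnion_le _ _
    _ = _ := by
      rw [tsum_fintype]
      exact Finset.sum_coe_sort _ fun E => ∫⁻ x in E, g x

theorem sum_setLIntegral_le (G : Mesh Ω) (g : Space d → ℝ≥0∞) :
    ∑ E ∈ G.finite_elements.toFinset, ∫⁻ x in E, g x ≤ ∫⁻ x in closure Ω, g x := by
  have h1 : ∀ E ∈ G.finite_elements.toFinset, ∫⁻ x in E, g x = ∫⁻ x in interior E, g x := by
    intro E hE
    have hE : E ∈ G.elements := by simpa using hE
    exact setLIntegral_congr (interior_ae_eq_of_null_frontier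
      ((convex hE).addHaar_frontier volume)).symm
  rw [Finset.sum_congr rfl h1, ← lintegral_biUnion_finset ?_ fun E _ =>
    isOpen_interior.measurableSet]
  · refine lintegral_mono_set (iUnion₂_subset fun E hE => ?_)
    exact interior_subset.trans (subset_closure (G := G) (by simpa using hE))
  · intro A hA B hB hAB
    exact G.disjoint_interior (by simpa using hA) (by simpa using hB) hAB

theorem setLIntegral_patch_le (G : Mesh Ω) (E : Set (Space d)) (g : Space d → ℝ≥0∞)
    [DecidablePred fun E' : Set (Space d) => (E' ∩ E).Nonempty] :
    ∫⁻ x in G.patch E, g x ≤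
      ∑ E' ∈ G.finite_elements.toFinset with (E' ∩ E).Nonempty, ∫⁻ x in E', g x := by
  set T := G.finite_elements.toFinset.filter fun E' => (E' ∩ E).Nonempty with hT
  have h : G.patch E ⊆ ⋃ E' : T, (E' : Set (Space d)) := by
    rintro x ⟨E', hE', hx⟩
    exact mem_iUnion.2 ⟨⟨E', by simpa [hT] using hE'⟩, hx⟩
  calc ∫⁻ x in G.patch E, g x ≤ _ := lintegral_mono_set h
    _ ≤ _ := lintegral_iUnion_le _ _
    _ = _ := by
      rw [tsum_fintype]
      exact Finset.sum_coe_sort T fun E => ∫⁻ x in E, g x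

open Classical in
/-- The patchwise means, weighted by the volumes of the elements, sum up to at most a multiple of
the integral over the whole domain. -/
theorem IsRegular.sum_div_mul_setLIntegral_patch_le {κ : ℝ≥0} (hκ : 1 ≤ κ)
    (hG : G.IsRegular κ) (hΩ : Bornology.IsBounded Ω) (g : Space d → ℝ≥0∞) :
    ∑ E ∈ G.finite_elements.toFinset,
        volume E / volume (G.patch E) * ∫⁻ x in G.patch E, g x ≤
      2 ^ d * κ ^ 2 * ∫⁻ x in closure Ω, g x := by
  set T := G.finite_elements.toFinset with hT
  calc ∑ E ∈ T, volume E / volume (G.patch E) * ∫⁻ x in G.patch E, g x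
      ≤ ∑ E ∈ T, volume E / volume (G.patch E) *
          ∑ E' ∈ T with (E' ∩ E).Nonempty, ∫⁻ x in E', g x := by
        gcongr with E hE
        exact setLIntegral_patch_le G E g
    _ = ∑ E' ∈ T, (∑ E ∈ T with (E' ∩ E).Nonempty, volume E / volume (G.patch E)) *
          ∫⁻ x in E', g x := by
        simp_rw [Finset.mul_sum, Finset.sum_mul, Finset.sum_filter]
        exact Finset.sum_comm
    _ ≤ ∑ E' ∈ T, 2 ^ d * κ ^ 2 * ∫⁻ x in E', g x := by
        gcongr with E' hE'
        exact hG.sum_volume_div_le hκ hΩ (by simpa [hT] using hE')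
    _ = 2 ^ d * κ ^ 2 * ∑ E' ∈ T, ∫⁻ x in E', g x := by rw [Finset.mul_sum]
    _ ≤ _ := by
        gcongr
        exact sum_setLIntegral_le G g

end Mesh

/-! ### The inverse estimate -/

/-- The embedding of `L^∞` into `L¹` for a finite measure. -/
noncomputable def lpTopToLpOne {X : Type*} [MeasurableSpace X] (μ : Measure X) [IsFiniteMeasure μ] :
    Lp ℝ ∞ μ →ₗ[ℝ] Lp ℝ 1 μ where
  toFun f := ((Lp.memLp f).mono_exponent le_top).toLp f
  map_add' f g := by
    rw [← MemLp.toLp_add]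
    exact MemLp.toLp_congr _ _ (Lp.coeFn_add f g)
  map_smul' c f := by
    rw [RingHom.id_apply, ← MemLp.toLp_const_smul]
    exact MemLp.toLp_congr _ _ (Lp.coeFn_smul c f)

theorem lpTopToLpOne_injective {X : Type*} [MeasurableSpace X] (μ : Measure X)
    [IsFiniteMeasure μ] : Function.Injective (lpTopToLpOne μ) := fun f g h =>
  Lp.ext ((MemLp.toLp_eq_toLp_iff ((Lp.memLp f).mono_exponent le_top)
    ((Lp.memLp g).mono_exponent le_top)).1 h)

/-- On a finite-dimensional space of bounded functions the `L^∞` norm is controlled by the `L¹`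
norm. -/
theorem exists_enorm_le_lintegral {X : Type*} [MeasurableSpace X] (μ : Measure X)
    [IsFiniteMeasure μ] (P : Submodule ℝ (Lp ℝ ∞ μ)) [FiniteDimensional ℝ P] :
    ∃ K : ℝ≥0, ∀ p ∈ P, ∀ᵐ x ∂μ, ‖p x‖ₑ ≤ K * ∫⁻ y, ‖p y‖ₑ ∂μ := by
  obtain ⟨K, -, hK⟩ := ((lpTopToLpOne μ).comp P.subtype).injective_iff_antilipschitz.1
    ((lpTopToLpOne_injective μ).comp P.injective_subtype)
  refine ⟨K, fun p hp => ?_⟩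
  have h := hK ⟨p, hp⟩ 0
  rw [map_zero, edist_zero_right, edist_zero_right] at h
  have h2 : ‖((lpTopToLpOne μ).comp P.subtype) ⟨p, hp⟩‖ₑ = ∫⁻ y, ‖p y‖ₑ ∂μ := by
    change ‖MemLp.toLp p ((Lp.memLp p).mono_exponent le_top)‖ₑ = _
    rw [Lp.enorm_toLp, eLpNorm_one_eq_lintegral_enorm]
  have h3 : ‖(⟨p, hp⟩ : P)‖ₑ = eLpNormEssSup p μ := by
    change ‖p‖ₑ = _
    rw [Lp.enorm_def, eLpNorm_exponent_top]
  rw [h2, h3] at h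
  filter_upwards [enorm_ae_le_eLpNormEssSup p μ] with x hx
  exact hx.trans h

theorem exists_map_affineEquiv_volume {d : ℕ} (F : Space d ≃ᵃ[ℝ] Space d) :
    ∃ c : ℝ≥0∞, c ≠ 0 ∧ volume.map F = c • (volume : Measure (Space d)) := by
  have hdet : LinearMap.det (F.linear : Space d →ₗ[ℝ] Space d) ≠ 0 :=
    (LinearEquiv.isUnit_det' F.linear).ne_zero
  refine ⟨ENNReal.ofReal |(LinearMap.det (F.linear : Space d →ₗ[ℝ] Space d))⁻¹|, ?_, ?_⟩
  · simpa using hdet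
  · have hF : (F : Space d → Space d) =
        (fun y => y + F 0) ∘ (F.linear : Space d →ₗ[ℝ] Space d) := by
      ext1 y
      simpa using congrFun F.toAffineMap.decomp y
    have hm : Measurable (F.linear : Space d →ₗ[ℝ] Space d) :=
      (LinearMap.continuous_of_finiteDimensional _).measurable
    rw [hF, ← Measure.map_map (measurable_add_const _) hm,
      Measure.map_linearMap_addHaar_eq_smul_addHaar volume hdet, Measure.map_smul,
      map_add_right_eq_self]

variable {d : ℕ} {Ω : Set (Space d)}

/-- The inverse estimate: by scaling to the reference simplex, a discrete function is bounded on each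
element by a uniform multiple of its mean over that element. -/
theorem exists_inverse_estimate
    (P : Submodule ℝ (Lp ℝ ∞ (volume.restrict (refSimplex d)))) [FiniteDimensional ℝ P] :
    ∃ K : ℝ≥0, ∀ (G : Mesh Ω), ∀ Q ∈ pressureSpace G P, ∀ E ∈ G.elements,
      volume E ≠ 0 → volume E ≠ ⊤ →
        ∀ᵐ x ∂(volume.restrict E), ‖Q x‖ₑ ≤ K * ((volume E)⁻¹ * ∫⁻ y in E, ‖Q y‖ₑ) := by
  have hfin : volume (refSimplex d) ≠ ⊤ := (Mesh.isBounded_refSimplex d).measure_lt_top.ne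
  have : IsFiniteMeasure (volume.restrict (refSimplex d)) := isFiniteMeasure_restrict.2 hfin
  obtain ⟨K, hK⟩ := exists_enorm_le_lintegral (volume.restrict (refSimplex d)) P
  refine ⟨K * (volume (refSimplex d)).toNNReal, fun G Q hQ E hE hE0 hEt => ?_⟩
  obtain ⟨p, hp, hQp⟩ := hQ.2 E hE
  obtain ⟨c, hc0, hc⟩ := exists_map_affineEquiv_volume (G.F E).symm
  have hEm : MeasurableSet E := (Mesh.isClosed hE).measurableSet
  have hemb : MeasurableEmbedding (G.F E).symm :=
    ((AffineEquiv.toContinuousAffineEquiv (G.F E).symm).toHomeomorph).measurableEmbedding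
  have hmap : (volume.restrict (refSimplex d)).map (G.F E).symm = c • volume.restrict E := by
    rw [← Mesh.symm_preimage hE, ← Measure.restrict_map hemb.measurable hEm, hc,
      Measure.restrict_smul]
  have hvol : volume (refSimplex d) = c * volume E := by
    have := congrArg (fun ν : Measure (Space d) => ν univ) hmap
    simpa [Measure.map_apply hemb.measurable MeasurableSet.univ] using this
  have hcE : c = volume (refSimplex d) * (volume E)⁻¹ := by
    rw [hvol, mul_assoc, ENNReal.mul_inv_cancel hE0 hEt, mul_one]
  have hint : ∫⁻ y in refSimplex d, ‖p y‖ₑ = c * ∫⁻ x in E, ‖Q x‖ₑ := by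
    rw [← smul_eq_mul, ← lintegral_smul_measure, ← hmap, hemb.lintegral_map]
    refine lintegral_congr_ae ?_
    filter_upwards [hQp] with y hy
    rw [hy]
  have hae : ∀ᵐ y ∂(volume.restrict (refSimplex d)),
      ‖Q ((G.F E).symm y)‖ₑ ≤ K * (c * ∫⁻ x in E, ‖Q x‖ₑ) := by
    filter_upwards [hQp, hK p hp] with y hy hy'
    rw [hy, ← hint]
    exact hy'
  rw [← hemb.ae_map_iff (p := fun x => ‖Q x‖ₑ ≤ K * (c * ∫⁻ x in E, ‖Q x‖ₑ)), hmap,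
    Measure.ae_ennreal_smul_measure_iff hc0] at hae
  filter_upwards [hae] with x hx
  refine hx.trans_eq ?_
  rw [hcE, ENNReal.coe_mul, ENNReal.coe_toNNReal hfin]
  ring

/-! ### Modulars and the Luxemburg norm -/

theorem ofReal_setAverage_abs {S : Set (Space d)} {f : Space d → ℝ} (hf : IntegrableOn f S)
    (hS0 : volume S ≠ 0) (hSt : volume S ≠ ⊤) :
    ENNReal.ofReal (⨍ x in S, |f x|) = (volume S)⁻¹ * ∫⁻ x in S, ‖f x‖ₑ := by
  have hs : 0 < volume.real S := ENNReal.toReal_pos hS0 hSt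
  rw [setAverage_eq, smul_eq_mul, ENNReal.ofReal_mul (by positivity),
    ENNReal.ofReal_inv_of_pos hs, ofReal_measureReal hSt]
  congr 1
  exact ofReal_integral_norm_eq_lintegral_enorm hf

theorem enorm_div_of_pos (x : ℝ) {t : ℝ} (ht : 0 < t) :
    ‖x / t‖ₑ = ‖x‖ₑ / ENNReal.ofReal t := by
  rw [div_eq_mul_inv, enorm_mul, Real.enorm_of_nonneg (inv_nonneg.2 ht.le),
    ENNReal.ofReal_inv_of_pos ht, div_eq_mul_inv]

theorem modular_congr {p u v : Space d → ℝ} (h : u =ᵐ[volume.restrict Ω] v) :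
    modular Ω p u = modular Ω p v :=
  lintegral_congr_ae (h.mono fun x hx => by simp only [hx])

/-- A bound `A ≥ 1` on the modular is absorbed by dividing by `A`, since the exponent is at least
one. -/
theorem modular_div_le_one (hΩ : MeasurableSet Ω) {p u : Space d → ℝ} (hp : ∀ x ∈ Ω, 1 ≤ p x)
    {A : ℝ≥0} (hA : 1 ≤ A) (hu : modular Ω p u ≤ A) : modular Ω p (fun x => u x / A) ≤ 1 := by
  have hA0 : (0 : ℝ) < A := zero_lt_one.trans_le (by exact_mod_cast hA)
  have hA' : (1 : ℝ≥0∞) ≤ A := ENNReal.one_le_coe_iff.2 hA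
  have hA1 : (A : ℝ≥0∞) ≠ 0 := (zero_lt_one.trans_le hA').ne'
  calc modular Ω p (fun x => u x / A) ≤ ∫⁻ x in Ω, (A : ℝ≥0∞)⁻¹ * ‖u x‖ₑ ^ p x := by
        refine setLIntegral_mono' hΩ fun x hx => ?_
        have h1 := hp x hx
        rw [enorm_div_of_pos _ hA0, ENNReal.ofReal_coe_nnreal,
          ENNReal.div_rpow_of_nonneg _ _ (by linarith), div_eq_mul_inv, mul_comm]
        gcongr
        calc (A : ℝ≥0∞) = (A : ℝ≥0∞) ^ (1 : ℝ) := (ENNReal.rpow_one _).symm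
          _ ≤ _ := ENNReal.rpow_le_rpow_of_exponent_le hA' h1
    _ = (A : ℝ≥0∞)⁻¹ * modular Ω p u := lintegral_const_mul' _ _ (by simpa using hA1)
    _ ≤ (A : ℝ≥0∞)⁻¹ * A := by gcongr
    _ = 1 := ENNReal.inv_mul_cancel hA1 ENNReal.coe_ne_top

theorem MemVarLebesgue.integrable (hΩ : IsOpen Ω) (hb : Bornology.IsBounded Ω)
    {p q : Space d → ℝ} (hp : ∀ x ∈ Ω, 1 ≤ p x) (hq : MemVarLebesgue Ω p q) :
    Integrable q (volume.restrict Ω) := by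
  refine ⟨hq.1.aestronglyMeasurable, ?_⟩
  calc ∫⁻ x in Ω, ‖q x‖ₑ ≤ ∫⁻ x in Ω, (‖q x‖ₑ ^ p x + 1) := by
        refine setLIntegral_mono' hΩ.measurableSet fun x hx => ?_
        rcases le_total ‖q x‖ₑ 1 with h | h
        · exact le_add_left h
        · refine le_add_right ?_
          calc ‖q x‖ₑ = ‖q x‖ₑ ^ (1 : ℝ) := (ENNReal.rpow_one _).symm
            _ ≤ _ := ENNReal.rpow_le_rpow_of_exponent_le h (hp x hx)
    _ = modular Ω p q + volume Ω := by
        rw [lintegral_add_right _ measurable_const, setLIntegral_one, modular]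
    _ < ⊤ := ENNReal.add_lt_top.2 ⟨hq.2, hb.measure_lt_top⟩

/-- A Luxemburg norm bound follows from a modular bound on the unit ball by homogeneity. -/
theorem luxemburgNorm_le_mul {p u v : Space d → ℝ} {C : ℝ≥0} (hC : C ≠ 0)
    (h : ∀ t : ℝ, 0 < t → modular Ω p (fun x => v x / t) ≤ 1 →
      modular Ω p (fun x => u x / (C * t)) ≤ 1) :
    luxemburgNorm Ω p u ≤ C * luxemburgNorm Ω p v := by
  have hC' : (C : ℝ≥0∞) ≠ 0 := ENNReal.coe_ne_zero.2 hC
  rw [mul_comm, ← ENNReal.div_le_iff_le_mul (Or.inl hC') (Or.inl ENNReal.coe_ne_top)]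
  refine le_sInf ?_
  rintro _ ⟨t, ⟨ht, hmod⟩, rfl⟩
  rw [ENNReal.div_le_iff_le_mul (Or.inl hC') (Or.inl ENNReal.coe_ne_top)]
  refine sInf_le ⟨C * t, ⟨by positivity, h t ht hmod⟩, ?_⟩
  rw [mul_comm, ENNReal.ofReal_mul ht.le, ENNReal.ofReal_coe_nnreal]

/-! ### Stability of local averaging -/

/-- If `|g|` is bounded on each element by `L` times the mean of `|f|` over the patch, and the modular
of `f` is at most one, then the modular of `g / L` is bounded by a constant that depends on the mesh
only through its regularity, and on the exponent only through its Hölder seminorm. -/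
theorem Mesh.IsRegular.exists_modular_bound (hd : d ≠ 0) (hb : Bornology.IsBounded Ω)
    (hfr : volume (frontier Ω) = 0) (κ M α : ℝ≥0) (hκ : 1 ≤ κ) (hα : 0 < α) :
    ∃ A : ℝ≥0, 1 ≤ A ∧ ∀ (G : Mesh Ω), G.IsRegular κ → ∀ p : Space d → ℝ,
      HolderOnWith M α p (closure Ω) → (∀ x ∈ closure Ω, 1 < p x) →
      ∀ (f g : Space d → ℝ) (L : ℝ≥0), 0 < L → Integrable f (volume.restrict Ω) →
      (∀ E ∈ G.elements, ∀ᵐ x ∂(volume.restrict E),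
        ‖g x‖ₑ ≤ L * ((volume (G.patch E))⁻¹ * ∫⁻ y in G.patch E, ‖f y‖ₑ)) →
      modular Ω p f ≤ 1 → modular Ω p (fun x => g x / L) ≤ A := by
  set c : ℝ := 2 ^ d * κ / volume.real (Metric.closedBall (0 : Space d) 1) with hc
  have hc0 : 0 ≤ c := by positivity
  set V : ℝ := volume.real (closure Ω) with hV
  set C₀ : ℝ≥0∞ :=
    ENNReal.ofReal (Real.exp (M * ((c * (V + 1)) ^ ((α : ℝ) / d) / ((α : ℝ) / d)))) with hC₀
  have hVt : volume (closure Ω) ≠ ⊤ := hb.closure.measure_lt_top.ne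
  have hAfin : C₀ * (2 ^ d * κ ^ 2 + volume (closure Ω)) ≠ ⊤ :=
    ENNReal.mul_ne_top ENNReal.ofReal_ne_top (ENNReal.add_ne_top.2 ⟨ENNReal.mul_ne_top
      (ENNReal.pow_ne_top ENNReal.ofNat_ne_top) (ENNReal.pow_ne_top ENNReal.coe_ne_top), hVt⟩)
  refine ⟨max 1 (C₀ * (2 ^ d * κ ^ 2 + volume (closure Ω))).toNNReal, le_max_left _ _, ?_⟩
  intro G hG p hpH hp1 f g L hL hf hfg hmod
  refine le_trans ?_ (ENNReal.coe_le_coe.2 (le_max_right _ _))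
  rw [ENNReal.coe_toNNReal hAfin]
  have hcl : volume.restrict (closure Ω) = volume.restrict Ω :=
    Measure.restrict_congr_set (closure_ae_eq_of_null_frontier hfr)
  have hfc : IntegrableOn f (closure Ω) := by
    rwa [IntegrableOn, hcl]
  have hmodc : ∫⁻ x in closure Ω, ‖f x‖ₑ ^ p x ≤ 1 := by
    rwa [hcl]
  set T := G.finite_elements.toFinset with hT
  have hTm : ∀ E ∈ T, E ∈ G.elements := fun E hE => by simpa [hT] using hE
  have hloc : ∀ E ∈ T, ∫⁻ x in E, ‖g x / L‖ₑ ^ p x ≤ C₀ *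
      (volume E / volume (G.patch E) * (∫⁻ y in G.patch E, ‖f y‖ₑ ^ p y) + volume E) := by
    intro E hE
    have hE := hTm E hE
    have hEm : MeasurableSet E := (Mesh.isClosed hE).measurableSet
    have hES : E ⊆ G.patch E := Mesh.subset_patch hE (by simpa using hG.nonempty hE)
    have hSc := Mesh.patch_subset G E
    have hS0 : volume (G.patch E) ≠ 0 := fun h => hG.volume_pos hE (measure_mono_null hES h)
    have hpt : ∀ᵐ x ∂(volume.restrict E), ‖g x / L‖ₑ ^ p x ≤ C₀ *
        ((volume (G.patch E))⁻¹ * (∫⁻ y in G.patch E, ‖f y‖ₑ ^ p y) + 1) := by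
      filter_upwards [hfg E hE, ae_restrict_mem hEm] with x hx hxE
      have hxc := Mesh.subset_closure hE hxE
      refine le_trans (ENNReal.rpow_le_rpow ?_ (by linarith [hp1 x hxc])) (rpow_laverage_le hd hα
        hc0 hS0 ?_ (Mesh.isClosed_patch G E).measurableSet
        (fun y hy => hG.dist_pow_le hb hE hxE hy) (fun y hy => hpH.dist_le hxc (hSc hy))
        (hp1 x hxc) (fun y hy => hp1 y (hSc hy)) (hfc.mono_set hSc).aestronglyMeasurable
        ((lintegral_mono_set hSc).trans hmodc))
      · rw [enorm_div_of_pos _ (NNReal.coe_pos.2 hL), ENNReal.ofReal_coe_nnreal]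
        exact ENNReal.div_le_of_le_mul' hx
      · rw [hV, ofReal_measureReal hVt]
        exact measure_mono hSc
    calc ∫⁻ x in E, ‖g x / L‖ₑ ^ p x ≤ ∫⁻ x in E, C₀ *
          ((volume (G.patch E))⁻¹ * (∫⁻ y in G.patch E, ‖f y‖ₑ ^ p y) + 1) :=
          lintegral_mono_ae hpt
      _ = _ := by
        rw [setLIntegral_const, div_eq_mul_inv]
        ring
  calc modular Ω p (fun x => g x / L) ≤ ∑ E ∈ T, ∫⁻ x in E, ‖g x / L‖ₑ ^ p x :=
        Mesh.setLIntegral_le_sum G _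
    _ ≤ ∑ E ∈ T, C₀ *
        (volume E / volume (G.patch E) * (∫⁻ y in G.patch E, ‖f y‖ₑ ^ p y) + volume E) :=
        Finset.sum_le_sum hloc
    _ = C₀ * (∑ E ∈ T, volume E / volume (G.patch E) * (∫⁻ y in G.patch E, ‖f y‖ₑ ^ p y)
        + ∑ E ∈ T, volume E) := by rw [← Finset.mul_sum, Finset.sum_add_distrib]
    _ ≤ C₀ * (2 ^ d * κ ^ 2 * 1 + volume (closure Ω)) := by
        gcongr
        · refine (hG.sum_div_mul_setLIntegral_patch_le hκ hb _).trans ?_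
          gcongr
        · simpa using Mesh.sum_setLIntegral_le G fun _ => 1
    _ = _ := by rw [mul_one]

end VarExpFEM

theorem proposition3p5 {d : ℕ} (hd : d = 2 ∨ d = 3)
    (Ω : Set (VarExpFEM.Space d)) (hΩ_open : IsOpen Ω) (hΩ_bdd : Bornology.IsBounded Ω)
    (hΩ_lip : VarExpFEM.HasLipschitzBoundary Ω)
    (G : ℕ → VarExpFEM.Mesh Ω) (hG : VarExpFEM.ShapeRegular G)
    (P : Submodule ℝ (Lp ℝ ∞ (volume.restrict (VarExpFEM.refSimplex d))))
    (hP : FiniteDimensional ℝ P)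
    (Pi : ℕ → (Lp ℝ 1 (volume.restrict Ω) →ₗ[ℝ] Lp ℝ 1 (volume.restrict Ω)))
    (hPi : VarExpFEM.IsStablePressureProjection G P Pi)
    (α : ℝ≥0) (hα₀ : 0 < α) (hα₁ : α < 1)
    (r : VarExpFEM.Space d → ℝ) (rn : ℕ → VarExpFEM.Space d → ℝ)
    (hr : VarExpFEM.holderNorm Ω α r < ⊤)
    (hrn : ∀ n, VarExpFEM.holderNorm Ω α (rn n) < ⊤)
    (hrn_one : ∀ n, ∀ x ∈ closure Ω, 1 < rn n x)
    (hconv : Tendsto (fun n => VarExpFEM.holderNorm Ω α (rn n - r)) atTop (𝓝 0)) :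
    ∃ C : ℝ≥0, ∀ n, ∀ q : VarExpFEM.Space d → ℝ, VarExpFEM.MemVarLebesgue Ω (rn n) q →
      ∃ hq : Integrable q (volume.restrict Ω),
        VarExpFEM.luxemburgNorm Ω (rn n) (Pi n (hq.toL1 q)) ≤
          C * VarExpFEM.luxemburgNorm Ω (rn n) q := by
  open VarExpFEM in
  have hd0 : d ≠ 0 := by omega
  have hfr := volume_frontier_eq_zero hΩ_open hΩ_lip
  have hcl : volume.restrict (closure Ω) = volume.restrict Ω :=
    Measure.restrict_congr_set (closure_ae_eq_of_null_frontier hfr)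
  obtain ⟨M, hM⟩ := exists_uniform_holder_bound hr hrn hconv
  obtain ⟨κ, hκ, hreg⟩ := hG.exists_isRegular hd0 hΩ_bdd
  obtain ⟨K, hK⟩ := exists_inverse_estimate (Ω := Ω) P
  obtain ⟨c, hc, hstab⟩ := hPi.stable
  obtain ⟨A, hA, hmod⟩ := Mesh.IsRegular.exists_modular_bound hd0 hΩ_bdd hfr κ M α hκ hα₀
  set L : ℝ≥0 := (K + 1) * c.toNNReal with hL
  have hL0 : 0 < L := mul_pos (by positivity) (Real.toNNReal_pos.2 hc)
  have hA0 : 0 < A := zero_lt_one.trans_le hA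
  have hone : ∀ n, ∀ x ∈ Ω, 1 ≤ rn n x := fun n x hx => (hrn_one n x (subset_closure hx)).le
  have hint : ∀ f : Lp ℝ 1 (volume.restrict Ω), IntegrableOn f (closure Ω) := fun f => by
    rw [IntegrableOn, hcl]
    exact L1.integrable_coeFn f
  -- On each element, the projection is pointwise controlled by the patch average of the data.
  have hpt : ∀ n (f : Lp ℝ 1 (volume.restrict Ω)), ∀ E ∈ (G n).elements,
      ∀ᵐ x ∂(volume.restrict E), ‖Pi n f x‖ₑ ≤
        L * ((volume ((G n).patch E))⁻¹ * ∫⁻ y in (G n).patch E, ‖f y‖ₑ) := by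
    intro n f E hE
    have hEc := Mesh.subset_closure hE
    have hSc := Mesh.patch_subset (G n) E
    have hES : E ⊆ (G n).patch E := Mesh.subset_patch hE (by simpa using (hreg n).nonempty hE)
    have hE0 := (hreg n).volume_pos hE
    have hS0 : volume ((G n).patch E) ≠ 0 := fun h => hE0 (measure_mono_null hES h)
    have hEt : volume E ≠ ⊤ := (hΩ_bdd.closure.subset hEc).measure_lt_top.ne
    have hSt : volume ((G n).patch E) ≠ ⊤ := (hΩ_bdd.closure.subset hSc).measure_lt_top.ne
    have h1 := ENNReal.ofReal_le_ofReal (hstab n f E hE)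
    rw [ENNReal.ofReal_mul hc.le, ofReal_setAverage_abs ((hint _).mono_set hEc) hE0 hEt,
      ofReal_setAverage_abs ((hint f).mono_set hSc) hS0 hSt] at h1
    filter_upwards [hK (G n) _ (hPi.mem n f) E hE hE0 hEt] with x hx
    refine hx.trans ?_
    calc _ ≤ ((K + 1 : ℝ≥0) : ℝ≥0∞) * (ENNReal.ofReal c *
          ((volume ((G n).patch E))⁻¹ * ∫⁻ y in (G n).patch E, ‖f y‖ₑ)) := by
          gcongr
          exact le_self_add
      _ = _ := by rw [← mul_assoc, hL, ENNReal.coe_mul, ENNReal.ofReal]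
  refine ⟨L * A, fun n q hq => ?_⟩
  have hqi := hq.integrable hΩ_open hΩ_bdd (hone n)
  refine ⟨hqi, luxemburgNorm_le_mul (mul_pos hL0 hA0).ne' fun t ht hqt => ?_⟩
  set f : Lp ℝ 1 (volume.restrict Ω) := t⁻¹ • hqi.toL1 q with hf
  have hfq : f =ᵐ[volume.restrict Ω] fun x => q x / t := by
    filter_upwards [Lp.coeFn_smul t⁻¹ (hqi.toL1 q), hqi.coeFn_toL1] with x hx hx'
    rw [hf, hx, _root_.Pi.smul_apply, hx', smul_eq_mul, div_eq_inv_mul]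
  have h1 := hmod (G n) (hreg n) (rn n) (hM n) (hrn_one n) f (Pi n f) L hL0
    (L1.integrable_coeFn f) (hpt n f) ((modular_congr hfq).trans_le hqt)
  refine le_trans (le_of_eq (modular_congr ?_))
    (modular_div_le_one hΩ_open.measurableSet (hone n) hA h1)
  have h2 : Pi n f = t⁻¹ • Pi n (hqi.toL1 q) := map_smul _ _ _
  filter_upwards [Lp.coeFn_smul t⁻¹ (Pi n (hqi.toL1 q))] with x hx
  rw [h2, hx, _root_.Pi.smul_apply, smul_eq_mul, NNReal.coe_mul]
  field_simp
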